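/- **Theorem 1.1.** For a family $f=(f_n(k))$ $(n\ge 1,\ 1\le k\le 2n-1)$ of rational numbers, consider the finite difference equation system $$\Delta^2 f_n(k)+4f_{n-1}(k)=0\qquad(n\ge 2,\ 1\le k\le 2n-3),$$ where $\Delta f_n(k)=f_n(k+1)-f_n(k)$, so that $\Delta^2 f_n(k)=f_n(k+2)-2f_n(k+1)+f_n(k)$, together with one of the following sets of initial values, in which $\sum_k f_{n-1}(k)$ is the sum over $1\le k\le 2n-3$: - [tan1] $f_1(1)=1$; $f_n(1)=0$ and $f_n(2)=2\sum_k f_{n-1}(k)$ for $n\ge 2$; - [sec1] $f_1(1)=1$; $f_n(1)=\sum_k f_{n-1}(k)$ and $f_n(2)=3\sum_k f_{n-1}(k)$ for $n\ge 2$. The system has a unique solution $(g_n(k))$ with the initial values [tan1], and a unique solution $(h_n(k))$ with the initial values [sec1]. Their row sums are $$\sum_{k=1}^{2n-1}g_n(k)=T_{2n-1}\quad(n\ge 1),\qquad \sum_{k=1}^{2n-1}h_n(k)=E_{2n}\quad(n\ge 1),$$ where the tangent numbers $T_{2n+1}$ and the secant numbers $E_{2n}$ are given by the Taylor expansions at $0$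 $$\tan u=\sum_{n\ge 0}T_{2n+1}\frac{u^{2n+1}}{(2n+1)!},\qquad \sec u=\frac1{\cos u}=\sum_{n\ge 0}E_{2n}\frac{u^{2n}}{(2n)!}.$$ -/

import Mathlib

/-!
A triangular array `(f_n(k))`, `n ≥ 1`, `1 ≤ k ≤ 2n - 1`, of rational numbers is represented by a
function `f : ℕ → ℕ → ℚ`, of which only the values `f n k` inside the triangle are ever used.
-/

/-- The sum `∑_k f_n(k)` of the `n`-th row, over `1 ≤ k ≤ 2n - 1`. -/
def rowSum (f : ℕ → ℕ → ℚ) (n : ℕ) : ℚ :=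
  ∑ k ∈ Finset.Icc 1 (2 * n - 1), f n k

/-- The finite difference equation system
`Δ² f_n(k) + 4 f_{n-1}(k) = 0` for `n ≥ 2` and `1 ≤ k ≤ 2n - 3`,
where `Δ f_n(k) = f_n(k+1) - f_n(k)` acts on the variable `k`. -/
def SolvesSystem (f : ℕ → ℕ → ℚ) : Prop :=
  ∀ n k : ℕ, 2 ≤ n → 1 ≤ k → k ≤ 2 * n - 3 →
    (fwdDiff 1)^[2] (f n) k + 4 * f (n - 1) k = 0

/-- The initial values [tan1]. -/
def Tan1 (f : ℕ → ℕ → ℚ) : Prop :=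
  f 1 1 = 1 ∧ ∀ n : ℕ, 2 ≤ n → f n 1 = 0 ∧ f n 2 = 2 * rowSum f (n - 1)

/-- The initial values [sec1]. -/
def Sec1 (f : ℕ → ℕ → ℚ) : Prop :=
  f 1 1 = 1 ∧ ∀ n : ℕ, 2 ≤ n → f n 1 = rowSum f (n - 1) ∧ f n 2 = 3 * rowSum f (n - 1)

/-- Two arrays have the same entries inside the triangle. -/
def SameTriangle (f f' : ℕ → ℕ → ℚ) : Prop :=
  ∀ n k : ℕ, 1 ≤ n → 1 ≤ k → k ≤ 2 * n - 1 → f n k = f' n k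

/-- `T_m`, the coefficient of `u ^ m / m!` in the Taylor expansion of `tan u` at `0`;
the tangent numbers are those with `m` odd. -/
noncomputable def tangentNumber (m : ℕ) : ℝ :=
  iteratedDeriv m Real.tan 0

/-- `E_m`, the coefficient of `u ^ m / m!` in the Taylor expansion of `sec u = 1 / cos u` at `0`;
the secant numbers are those with `m` even. -/
noncomputable def secantNumber (m : ℕ) : ℝ :=
  iteratedDeriv m (fun u : ℝ => 1 / Real.cos u) 0

open Finset Filter Topology
open scoped ContDiff

/-! ### The finite difference system -/

/-! Since Δ² lowers the lower index of a binomial coefficient by two, each row has a Newton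
expansion in the first two entries of the rows up to it (`SolvesSystem.apply_eq_sum`). Summing it
and inserting the initial values gives a binomial recurrence for the row sums alone
(`SolvesSystem.rowSum_eq`). Taylor coefficients obey the same recurrence: for tan by `(1 + cos 2u)
tan u = sin 2u`, for sec by adding the relations from `(1 + cos 2u) sec u = 2 cos u` and `(1 + cos
2u) sec' u = 2 sin u`, whose right-hand sides cancel. -/

theorem fwdDiff_one_iterate_two (u : ℕ → ℚ) (k : ℕ) :
    (fwdDiff 1)^[2] u k = u (k + 2) - 2 * u (k + 1) + u k := by
  simp only [Function.iterate_succ, Function.iterate_zero, Function.comp, id, fwdDiff]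
  ring

/-- The system as a recurrence that determines a row from the previous row and its first two
entries. -/
theorem SolvesSystem.recurrence {f : ℕ → ℕ → ℚ} (hf : SolvesSystem f) {m k : ℕ}
    (hk : k ≤ 2 * m) :
    f (m + 2) (k + 3) = 2 * f (m + 2) (k + 2) - f (m + 2) (k + 1) - 4 * f (m + 1) (k + 1) := by
  have h := hf (m + 2) (k + 1) (by omega) (by omega) (by omega)
  rw [fwdDiff_one_iterate_two] at h
  simp only [Nat.add_assoc, Nat.reduceAdd, show m + 2 - 1 = m + 1 from rfl] at h
  linarith

theorem rowSum_succ (f : ℕ → ℕ → ℚ) (m : ℕ) :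
    rowSum f (m + 1) = ∑ k ∈ range (2 * m + 1), f (m + 1) (k + 1) := by
  rw [rowSum, show 2 * (m + 1) - 1 = 2 * m + 1 by omega, Finset.range_eq_Ico,
    Finset.sum_Ico_add' (fun k => f (m + 1) k) 0 (2 * m + 1) 1]
  rfl

/-- Initial values in which the first two entries of each row are fixed multiples of the sum of the
previous row. -/
def HasInitialValues (α β : ℚ) (f : ℕ → ℕ → ℚ) : Prop :=
  f 1 1 = 1 ∧ ∀ m : ℕ, f (m + 2) 1 = α * rowSum f (m + 1) ∧ f (m + 2) 2 = β * rowSum f (m + 1)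

theorem tan1_iff (f : ℕ → ℕ → ℚ) : Tan1 f ↔ HasInitialValues 0 2 f := by
  refine and_congr_right fun _ => ⟨fun h m => ?_, fun h n hn => ?_⟩
  · simpa using h (m + 2) (by omega)
  · obtain ⟨m, rfl⟩ := Nat.exists_eq_add_of_le' hn
    simpa using h m

theorem sec1_iff (f : ℕ → ℕ → ℚ) : Sec1 f ↔ HasInitialValues 1 3 f := by
  refine and_congr_right fun _ => ⟨fun h m => ?_, fun h n hn => ?_⟩
  · simpa using h (m + 2) (by omega)
  · obtain ⟨m, rfl⟩ := Nat.exists_eq_add_of_le' hn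
    simpa using h m

/-- The row with first two entries `a` and `b` that lies below the row `r`. -/
def nextRow (r : ℕ → ℚ) (a b : ℚ) : ℕ → ℚ
  | 0 => 0
  | 1 => a
  | 2 => b
  | k + 3 => 2 * nextRow r a b (k + 2) - nextRow r a b (k + 1) - 4 * r (k + 1)

/-- The solution of the system with the initial values `HasInitialValues α β`. -/
def solution (α β : ℚ) : ℕ → ℕ → ℚ
  | 0 => fun _ => 0
  | 1 => fun _ => 1
  | m + 2 =>
    let s := ∑ k ∈ Icc 1 (2 * (m + 1) - 1), solution α β (m + 1) k
    nextRow (solution α β (m + 1)) (α * s) (β * s)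

theorem solution_solvesSystem (α β : ℚ) : SolvesSystem (solution α β) := by
  intro n k hn hk _
  obtain ⟨m, rfl⟩ := Nat.exists_eq_add_of_le' hn
  obtain ⟨l, rfl⟩ := Nat.exists_eq_add_of_le' hk
  rw [fwdDiff_one_iterate_two]
  simp only [Nat.add_assoc, Nat.reduceAdd, show m + 2 - 1 = m + 1 from rfl]
  rw [solution, nextRow]
  ring

theorem solution_hasInitialValues (α β : ℚ) : HasInitialValues α β (solution α β) := by
  refine ⟨by rw [solution], fun m => ?_⟩
  rw [solution, nextRow, nextRow]
  exact ⟨rfl, rfl⟩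

theorem SolvesSystem.sameTriangle {α β : ℚ} {f f' : ℕ → ℕ → ℚ} (hf : SolvesSystem f)
    (hi : HasInitialValues α β f) (hf' : SolvesSystem f') (hi' : HasInitialValues α β f') :
    SameTriangle f f' := by
  have key : ∀ m k : ℕ, k ≤ 2 * m → f (m + 1) (k + 1) = f' (m + 1) (k + 1) := by
    intro m
    induction m with
    | zero =>
      intro k hk
      obtain rfl : k = 0 := by omega
      exact hi.1.trans hi'.1.symm
    | succ m ih =>
      have hs : rowSum f (m + 1) = rowSum f' (m + 1) := by
        rw [rowSum_succ, rowSum_succ]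
        exact sum_congr rfl fun k hk => ih k (by have := mem_range.1 hk; omega)
      intro k
      induction k using Nat.strong_induction_on with
      | _ k ihk =>
        intro hk
        match k, ihk, hk with
        | 0, _, _ => rw [(hi.2 m).1, (hi'.2 m).1, hs]
        | 1, _, _ => rw [(hi.2 m).2, (hi'.2 m).2, hs]
        | k + 2, ihk, hk =>
          have h0 := ihk k (by omega) (by omega)
          have h1 := ihk (k + 1) (by omega) (by omega)
          have h2 := ih k (by omega)
          have e := hf.recurrence (m := m) (k := k) (by omega)
          have e' := hf'.recurrence (m := m) (k := k) (by omega)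
          simp only [Nat.add_assoc, Nat.reduceAdd] at h0 h1 h2 e e' ⊢
          rw [e, e', h0, h1, h2]
  intro n k hn hk hkn
  obtain ⟨m, rfl⟩ := Nat.exists_eq_add_of_le' hn
  obtain ⟨l, rfl⟩ := Nat.exists_eq_add_of_le' hk
  exact key m l (by omega)

/-! ### Row sums -/

/-- Every solution in terms of the first two entries of its rows. -/
theorem SolvesSystem.apply_eq_sum {f : ℕ → ℕ → ℚ} (hf : SolvesSystem f) (m : ℕ) :
    ∀ k ≤ 2 * m, f (m + 1) (k + 1) = ∑ i ∈ range (m + 1), (-4 : ℚ) ^ i *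
      (f (m - i + 1) 1 * (k.choose (2 * i) : ℚ) +
        (f (m - i + 1) 2 - f (m - i + 1) 1) * (k.choose (2 * i + 1) : ℚ)) := by
  induction m with
  | zero =>
    intro k hk
    obtain rfl : k = 0 := by omega
    simp
  | succ m ih =>
    intro k
    induction k using Nat.strong_induction_on with
    | _ k ihk =>
      intro hk
      match k, ihk, hk with
      | 0, _, _ =>
        rw [sum_range_succ']
        -- Only `i = 0` survives, as `k` is below every other lower index.
        simp [Nat.choose_eq_zero_of_lt, Nat.mul_add]
      | 1, _, _ =>
        rw [sum_range_succ', sum_eq_zero]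
        · simp
        · intro i _
          rw [Nat.choose_eq_zero_of_lt (by omega), Nat.choose_eq_zero_of_lt (by omega)]
          simp
      | k + 2, ihk, hk =>
        have h0 := ihk k (by omega) (by omega)
        have h1 := ihk (k + 1) (by omega) (by omega)
        have h2 := ih k (by omega)
        have e := hf.recurrence (m := m) (k := k) (by omega)
        simp only [Nat.add_assoc, Nat.reduceAdd] at h0 h1 h2 e ⊢
        let T : ℕ → ℕ → ℚ := fun k i => (-4 : ℚ) ^ i *
          (f (m + 1 - i + 1) 1 * (k.choose (2 * i) : ℚ) +
            (f (m + 1 - i + 1) 2 - f (m + 1 - i + 1) 1) * (k.choose (2 * i + 1) : ℚ))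
        let U : ℕ → ℚ := fun i => (-4 : ℚ) ^ i *
          (f (m - i + 1) 1 * (k.choose (2 * i) : ℚ) +
            (f (m - i + 1) 2 - f (m - i + 1) 1) * (k.choose (2 * i + 1) : ℚ))
        -- Pascal's rule twice: Δ² shifts the index `i` by one and releases a factor -4.
        have hT : ∀ i, T (k + 2) (i + 1) = 2 * T (k + 1) (i + 1) - T k (i + 1) - 4 * U i := by
          intro i
          simp only [T, U, Nat.mul_add, Nat.mul_one, Nat.add_sub_add_right, Nat.choose_succ_succ',
            pow_succ]
          push_cast
          ring_nf
        have hT0 : T (k + 2) 0 = 2 * T (k + 1) 0 - T k 0 := by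
          simp [T]
          ring
        rw [e, h0, h1, h2]
        change 2 * ∑ i ∈ range (m + 1 + 1), T (k + 1) i - ∑ i ∈ range (m + 1 + 1), T k i -
          4 * ∑ i ∈ range (m + 1), U i = ∑ i ∈ range (m + 1 + 1), T (k + 2) i
        simp only [sum_range_succ' _ (m + 1), hT, hT0, sum_sub_distrib, ← mul_sum]
        ring

theorem SolvesSystem.rowSum_eq {f : ℕ → ℕ → ℚ} (hf : SolvesSystem f) (m : ℕ) :
    rowSum f (m + 1) = ∑ i ∈ range (m + 1), (-4 : ℚ) ^ i *
      (f (m - i + 1) 1 * ((2 * m + 1).choose (2 * i + 1) : ℚ) +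
        (f (m - i + 1) 2 - f (m - i + 1) 1) * ((2 * m + 1).choose (2 * i + 2) : ℚ)) := by
  -- The hockey-stick identity.
  have hock : ∀ N r : ℕ, ((N.choose (r + 1) : ℕ) : ℚ) = ∑ k ∈ range N, (k.choose r : ℚ) := by
    intro N r
    induction N with
    | zero => simp
    | succ N ih => rw [sum_range_succ, ← ih, Nat.choose_succ_succ']; push_cast; ring
  rw [rowSum_succ, sum_congr rfl fun k hk =>
    hf.apply_eq_sum m k (by have := mem_range.1 hk; omega), sum_comm]
  refine sum_congr rfl fun i _ => ?_
  rw [hock, hock, ← mul_sum, sum_add_distrib, mul_sum, mul_sum]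

/-! ### Taylor coefficients -/

theorem iteratedDeriv_cos_two_mul_even (j : ℕ) :
    iteratedDeriv (2 * j) (fun u : ℝ => Real.cos (2 * u)) 0 = (-4) ^ j := by
  rw [iteratedDeriv_comp_const_mul Real.contDiff_cos 2]
  simp [Real.iteratedDeriv_even_cos, pow_mul, ← mul_pow]
  norm_num

theorem iteratedDeriv_cos_two_mul_odd (j : ℕ) :
    iteratedDeriv (2 * j + 1) (fun u : ℝ => Real.cos (2 * u)) 0 = 0 := by
  rw [iteratedDeriv_comp_const_mul Real.contDiff_cos 2]
  simp

theorem sum_range_two_mul {M : Type*} [AddCommMonoid M] (F : ℕ → M) (N : ℕ) :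
    ∑ i ∈ range (2 * N), F i = ∑ j ∈ range N, (F (2 * j) + F (2 * j + 1)) := by
  induction N with
  | zero => simp
  | succ N ih => rw [Nat.mul_succ, sum_range_succ, sum_range_succ, ih, sum_range_succ, add_assoc]

/-- The Leibniz formula for the product with `1 + cos 2u`. -/
theorem iteratedDeriv_one_add_cos_mul {F : ℝ → ℝ} (hF : ContDiffAt ℝ ∞ F 0) {m N : ℕ}
    (hm : m < 2 * N) :
    iteratedDeriv m (fun u => F u + Real.cos (2 * u) * F u) 0 = iteratedDeriv m F 0 +
      ∑ j ∈ range N, (m.choose (2 * j) : ℝ) * (-4) ^ j * iteratedDeriv (m - 2 * j) F 0 := by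
  have hc : ContDiffAt ℝ m (fun u : ℝ => Real.cos (2 * u)) 0 := by fun_prop
  have hF' : ContDiffAt ℝ m F 0 := hF.of_le (by exact_mod_cast le_top)
  rw [iteratedDeriv_fun_add hF' (hc.mul hF'), iteratedDeriv_fun_mul hc hF',
    sum_subset (range_subset_range.2 (show m + 1 ≤ 2 * N by omega)), sum_range_two_mul]
  · simp only [iteratedDeriv_cos_two_mul_even, iteratedDeriv_cos_two_mul_odd, mul_zero, zero_mul,
      add_zero]
  · intro i _ hi
    rw [Nat.choose_eq_zero_of_lt (by simpa using hi)]
    simp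

theorem contDiffAt_tan_zero : ContDiffAt ℝ ∞ Real.tan 0 :=
  Real.contDiffAt_tan.2 (by simp)

theorem contDiffAt_sec_zero : ContDiffAt ℝ ω (fun u : ℝ => 1 / Real.cos u) 0 :=
  contDiffAt_const.div Real.contDiff_cos.contDiffAt (by simp)

/-- From `1 + cos 2u = 2 cos² u`; at the zeros of cos both sides vanish because division by zero
gives zero. -/
theorem tan_add_cos_two_mul_tan :
    (fun u : ℝ => Real.tan u + Real.cos (2 * u) * Real.tan u) = fun u => Real.sin (2 * u) := by
  funext u
  rw [Real.cos_two_mul, Real.sin_two_mul, Real.tan_eq_sin_div_cos]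
  by_cases h : Real.cos u = 0
  · simp [h]
  · field_simp
    ring

theorem sec_add_cos_two_mul_sec :
    (fun u : ℝ => 1 / Real.cos u + Real.cos (2 * u) * (1 / Real.cos u)) =
      fun u => 2 * Real.cos u := by
  funext u
  rw [Real.cos_two_mul]
  by_cases h : Real.cos u = 0
  · simp [h]
  · field_simp
    ring

/-- Stated only near 0, where cos is nonzero and sec is differentiable; the germ determines the
Taylor coefficients. -/
theorem deriv_sec_add_cos_two_mul_deriv_sec :
    (fun u : ℝ => deriv (fun u : ℝ => 1 / Real.cos u) u +
      Real.cos (2 * u) * deriv (fun u : ℝ => 1 / Real.cos u) u) =ᶠ[𝓝 0]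
      fun u => 2 * Real.sin u := by
  filter_upwards [Real.continuous_cos.continuousAt.eventually_ne
    (show Real.cos 0 ≠ 0 by simp)] with u hu
  have h : deriv (fun u : ℝ => 1 / Real.cos u) u = Real.sin u / Real.cos u ^ 2 := by
    simpa using ((Real.hasDerivAt_cos u).fun_inv hu).deriv
  rw [h, Real.cos_two_mul]
  field_simp
  ring

theorem tangentNumber_recurrence (m : ℕ) :
    tangentNumber (2 * m + 1) + ∑ j ∈ range (m + 1),
      ((2 * m + 1).choose (2 * j) : ℝ) * (-4) ^ j * tangentNumber (2 * m + 1 - 2 * j) =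
      2 * (-4) ^ m := by
  have h := iteratedDeriv_one_add_cos_mul contDiffAt_tan_zero
    (show 2 * m + 1 < 2 * (m + 1) by omega)
  rw [tan_add_cos_two_mul_tan, iteratedDeriv_comp_const_mul Real.contDiff_sin 2] at h
  refine h.symm.trans ?_
  simp [pow_succ, pow_mul]
  rw [mul_right_comm, ← mul_pow]
  norm_num [mul_comm]

theorem secantNumber_recurrence (m : ℕ) :
    secantNumber (2 * m + 2) + ∑ j ∈ range (m + 2),
      ((2 * m + 2).choose (2 * j) : ℝ) * (-4) ^ j * secantNumber (2 * m + 2 - 2 * j) =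
      -2 * (-1) ^ m := by
  have h := iteratedDeriv_one_add_cos_mul (contDiffAt_sec_zero.of_le le_top)
    (show 2 * m + 2 < 2 * (m + 2) by omega)
  rw [sec_add_cos_two_mul_sec, iteratedDeriv_const_mul_field,
    show 2 * m + 2 = 2 * (m + 1) by ring] at h
  refine h.symm.trans ?_
  simp [Real.iteratedDeriv_even_cos, pow_succ]

theorem secantNumber_recurrence_deriv (m : ℕ) :
    secantNumber (2 * m + 2) + ∑ j ∈ range (m + 1),
      ((2 * m + 1).choose (2 * j) : ℝ) * (-4) ^ j * secantNumber (2 * m + 2 - 2 * j) =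
      2 * (-1) ^ m := by
  have hd : ContDiffAt ℝ ∞ (deriv fun u : ℝ => 1 / Real.cos u) 0 :=
    contDiffAt_sec_zero.analyticAt.deriv.contDiffAt
  have h := iteratedDeriv_one_add_cos_mul hd (show 2 * m + 1 < 2 * (m + 1) by omega)
  rw [deriv_sec_add_cos_two_mul_deriv_sec.iteratedDeriv_eq, iteratedDeriv_const_mul_field] at h
  simp only [← iteratedDeriv_succ'] at h
  have hs : iteratedDeriv (2 * m + 1) Real.sin 0 = (-1) ^ m := by
    simp
  rw [hs] at h
  rw [h, secantNumber]
  congr 1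
  refine sum_congr rfl fun j hj => ?_
  have := mem_range.1 hj
  rw [secantNumber, show 2 * m + 2 - 2 * j = 2 * m + 1 - 2 * j + 1 by omega]

/-! ### Identification of the row sums -/

theorem rowSum_eq_tangentNumber {g : ℕ → ℕ → ℚ} (hg : SolvesSystem g)
    (hi : HasInitialValues 0 2 g) (m : ℕ) :
    (rowSum g (m + 1) : ℝ) = tangentNumber (2 * m + 1) := by
  induction m using Nat.strong_induction_on with
  | _ m ih =>
    have h := tangentNumber_recurrence m
    rw [sum_range_succ'] at h
    rw [hg.rowSum_eq, sum_range_succ]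
    have hterm : ∀ i ∈ range m, (-4 : ℚ) ^ i *
        (g (m - i + 1) 1 * ((2 * m + 1).choose (2 * i + 1) : ℚ) +
          (g (m - i + 1) 2 - g (m - i + 1) 1) * ((2 * m + 1).choose (2 * i + 2) : ℚ)) =
        (-4 : ℚ) ^ i * (2 * rowSum g (m - 1 - i + 1) * ((2 * m + 1).choose (2 * i + 2) : ℚ)) := by
      intro i hi'
      have := mem_range.1 hi'
      rw [show m - i + 1 = m - 1 - i + 2 by omega, (hi.2 _).1, (hi.2 _).2]
      ring
    rw [sum_congr rfl hterm]
    have hsum : (∑ i ∈ range m, (-4 : ℝ) ^ i *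
        (2 * (rowSum g (m - 1 - i + 1) : ℝ) * ((2 * m + 1).choose (2 * i + 2) : ℝ))) =
        -(1 / 2) * ∑ j ∈ range m, ((2 * m + 1).choose (2 * (j + 1)) : ℝ) * (-4) ^ (j + 1) *
          tangentNumber (2 * m + 1 - 2 * (j + 1)) := by
      rw [mul_sum]
      refine sum_congr rfl fun i hi' => ?_
      have := mem_range.1 hi'
      rw [ih (m - 1 - i) (by omega),
        show 2 * m + 1 - 2 * (i + 1) = 2 * (m - 1 - i) + 1 by omega]
      ring_nf
    push_cast
    rw [hsum]
    -- In the last term, `g 1 2`, outside the triangle, has coefficient zero; the remaining `(-4) ^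
    -- m` is half the right-hand side of `h`.
    simp [hi.1] at h ⊢
    linarith

theorem secantNumber_zero : secantNumber 0 = 1 := by
  simp [secantNumber]

theorem rowSum_eq_secantNumber {h : ℕ → ℕ → ℚ} (hh : SolvesSystem h)
    (hi : HasInitialValues 1 3 h) (m : ℕ) :
    (rowSum h (m + 1) : ℝ) = secantNumber (2 * m + 2) := by
  induction m using Nat.strong_induction_on with
  | _ m ih =>
    have e := secantNumber_recurrence m
    have e' := secantNumber_recurrence_deriv m
    rw [sum_range_succ'] at e e'
    have hext : ∑ j ∈ range m, ((2 * m + 1).choose (2 * (j + 1)) : ℝ) * (-4) ^ (j + 1) *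
        secantNumber (2 * m + 2 - 2 * (j + 1)) = ∑ j ∈ range (m + 1),
          ((2 * m + 1).choose (2 * (j + 1)) : ℝ) * (-4) ^ (j + 1) *
            secantNumber (2 * m + 2 - 2 * (j + 1)) := by
      rw [sum_range_succ, Nat.choose_eq_zero_of_lt (show 2 * m + 1 < 2 * (m + 1) by omega)]
      simp
    rw [hext] at e'
    rw [hh.rowSum_eq]
    have hsum : ∑ i ∈ range (m + 1), (-4 : ℝ) ^ i *
        ((h (m - i + 1) 1 : ℝ) * ((2 * m + 1).choose (2 * i + 1) : ℝ) +
          ((h (m - i + 1) 2 : ℝ) - (h (m - i + 1) 1 : ℝ)) *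
            ((2 * m + 1).choose (2 * i + 2) : ℝ)) =
        -(1 / 4) * (∑ j ∈ range (m + 1), ((2 * m + 2).choose (2 * (j + 1)) : ℝ) * (-4) ^ (j + 1) *
            secantNumber (2 * m + 2 - 2 * (j + 1)) +
          ∑ j ∈ range (m + 1), ((2 * m + 1).choose (2 * (j + 1)) : ℝ) * (-4) ^ (j + 1) *
            secantNumber (2 * m + 2 - 2 * (j + 1))) := by
      -- With `N = 2m + 1`, Pascal's rule turns the weight `C(N, 2i+1) + 2 C(N, 2i+2)` into `C(N+1,
      -- 2i+2) + C(N, 2i+2)`, one summand from each secant recurrence.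
      rw [← sum_add_distrib, mul_sum]
      refine sum_congr rfl fun i hi' => ?_
      have him := mem_range.1 hi'
      rw [show 2 * m + 2 - 2 * (i + 1) = 2 * (m - i) by omega,
        show 2 * (i + 1) = 2 * i + 1 + 1 by ring, Nat.choose_succ_succ' (2 * m + 1) (2 * i + 1)]
      rcases Nat.lt_or_ge i m with hlt | hge
      · have hS := ih (m - i - 1) (by omega)
        rw [show 2 * (m - i - 1) + 2 = 2 * (m - i) by omega] at hS
        rw [← hS, show m - i + 1 = m - i - 1 + 2 by omega, (hi.2 _).1, (hi.2 _).2]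
        push_cast
        ring
      -- The top row enters through `h 1 1 = 1 = E_0`; the entry `h 1 2` is killed by its binomial
      -- coefficient.
      · obtain rfl : i = m := by omega
        rw [Nat.choose_eq_zero_of_lt (show 2 * i + 1 < 2 * i + 1 + 1 by omega)]
        simp [hi.1, secantNumber_zero]
        ring
    push_cast
    rw [hsum]
    simp at e e' ⊢
    linarith

theorem theorem1p1 :
    ((∃ g : ℕ → ℕ → ℚ, SolvesSystem g ∧ Tan1 g) ∧
      (∀ g g' : ℕ → ℕ → ℚ, SolvesSystem g → Tan1 g → SolvesSystem g' → Tan1 g' →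
        SameTriangle g g') ∧
      (∀ g : ℕ → ℕ → ℚ, SolvesSystem g → Tan1 g →
        ∀ n : ℕ, 1 ≤ n → (rowSum g n : ℝ) = tangentNumber (2 * n - 1))) ∧
    ((∃ h : ℕ → ℕ → ℚ, SolvesSystem h ∧ Sec1 h) ∧
      (∀ h h' : ℕ → ℕ → ℚ, SolvesSystem h → Sec1 h → SolvesSystem h' → Sec1 h' →
        SameTriangle h h') ∧
      (∀ h : ℕ → ℕ → ℚ, SolvesSystem h → Sec1 h →
        ∀ n : ℕ, 1 ≤ n → (rowSum h n : ℝ) = secantNumber (2 * n))) := by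
  simp only [tan1_iff, sec1_iff]
  refine ⟨⟨⟨_, solution_solvesSystem 0 2, solution_hasInitialValues 0 2⟩,
      fun g g' hg hi hg' hi' => hg.sameTriangle hi hg' hi', fun g hg hi n hn => ?_⟩,
    ⟨_, solution_solvesSystem 1 3, solution_hasInitialValues 1 3⟩,
      fun h h' hh hi hh' hi' => hh.sameTriangle hi hh' hi', fun h hh hi n hn => ?_⟩
  · obtain ⟨m, rfl⟩ := Nat.exists_eq_add_of_le' hn
    exact rowSum_eq_tangentNumber hg hi m
  · obtain ⟨m, rfl⟩ := Nat.exists_eq_add_of_le' hn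
    exact rowSum_eq_secantNumber hh hi m
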